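/- All graphs are finite and may have parallel edges and loops; a loop contributes $2$ to the degree of its vertex. An \emph{immersion} $\theta$ of a graph $H$ in a graph $G$ maps the vertices of $H$ injectively to vertices of $G$, and the edges of $H$ to pairwise edge-disjoint connected subgraphs of $G$, such that whenever $e\in E(H)$ is incident with $v\in V(H)$, the vertex $\theta(v)$ belongs to $\theta(e)$, and if moreover $e$ is a loop, then $\theta(e)$ contains a cycle through $\theta(v)$. It is \emph{strong} if $\theta(v)$ does not belong to $\theta(e)$ whenever $e\in E(H)$ is not incident with $v\in V(H)$. A \emph{multistar} is a connected loopless graph $H$ with at least three vertices that has a vertex $c(H)$, its \emph{center} (necessarily unique), incident with all its edges; its other vertices are its \emph{rays}, and $R(H)$ denotes the set of rays. Let $S_{n,k}$ be the multistar with $n$ rays, each of degree $k$. A \emph{$k$-system of magnitude $d$} in a graph $G$ is a pair $(H,\sigma)$, where $H$ is a multistar and $\sigma$ is a strong immersion of $H$ in $G$, such that $H$ has at least $d$ edges, every ray of $H$ has degree at most $k$ in $H$, and for each $v\in R(H)$ no edge cut of size less than $k$ in $G$ separates $\sigma(c(H))$ from $\sigma(v)$. A strong immersion $\theta$ of $S_{n,k}$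 in $G$ \emph{respects} $(H,\sigma)$ if $\theta(c(S_{n,k}))=\sigma(c(H))$ and $\theta(R(S_{n,k}))\subseteq\sigma(R(H))$. \textbf{Theorem.} Let $k\ge 3$ and $n\ge 2$ be integers and let $d(k)=(2k+1)^{8k+4}k^2(k+1)$. If $(H,\sigma)$ is a $k$-system of magnitude at least $d(k)n$ in a graph $G$, then there is a strong immersion of $S_{n,k}$ in $G$ that respects $(H,\sigma)$. -/

import Mathlib

namespace Graph

/-- The degree of a vertex in a multigraph: every loop contributes two. -/
noncomputable def degree {α β : Type*} (G : Graph α β) (v : α) : ℕ∞ :=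
  (G.incidenceSet v).encard + (G.loopSet v).encard

/-- There is a walk (possibly of length zero) from `x` to `y` in `G`. -/
def Reachable {α β : Type*} (G : Graph α β) (x y : α) : Prop :=
  Relation.ReflTransGen G.Adj x y

/-- A graph is connected if it has a vertex and any two of its vertices are joined by a walk. -/
def Connected {α β : Type*} (G : Graph α β) : Prop :=
  G.vertexSet.Nonempty ∧ ∀ x ∈ G.vertexSet, ∀ y ∈ G.vertexSet, G.Reachable x y

/-- A cycle: a finite connected graph all of whose vertices have degree two. One vertex with a loop,
and two vertices joined by two parallel edges, are cycles. -/
def IsCycle {α β : Type*} (C : Graph α β) : Prop :=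
  C.vertexSet.Finite ∧ C.Connected ∧ ∀ v ∈ C.vertexSet, C.degree v = 2

/-- A set `K` of edges of `G` whose deletion leaves no walk from `x` to `y`. -/
def IsEdgeCutSeparating {α β : Type*} (G : Graph α β) (K : Set β) (x y : α) : Prop :=
  K ⊆ G.edgeSet ∧ ¬ (G.deleteEdges K).Reachable x y

/-- `H` is a multistar with center `c`: a connected loopless graph with at least three vertices
in which `c` is incident with all edges. (The center is then unique.) -/
structure IsMultistar {γ δ : Type*} (H : Graph γ δ) (c : γ) : Prop where
  connected : H.Connected
  three_le_card : 3 ≤ H.vertexSet.encard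
  no_loops : ∀ e v, ¬ H.IsLoopAt e v
  center_mem : c ∈ H.vertexSet
  inc_center : ∀ e ∈ H.edgeSet, H.Inc e c

/-- The rays of a multistar `H` with center `c`: all the vertices other than the center. -/
def rays {γ δ : Type*} (H : Graph γ δ) (c : γ) : Set γ := H.vertexSet \ {c}

/-- The graph `S_{n,k}`: the center is `none`, the rays are `some i`, and
each ray `some i` is joined to the center by the `k` parallel edges `(i, j)`. -/
def multistar (n k : ℕ) : Graph (Option (Fin n)) (Fin n × Fin k) where
  vertexSet := Set.univ
  IsLink e x y := (x = none ∧ y = some e.1) ∨ (x = some e.1 ∧ y = none)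
  isLink_symm := fun _ _ => ⟨fun _ _ h => by tauto⟩
  eq_or_eq_of_isLink_of_isLink := by
    rintro e x y v w (⟨rfl, rfl⟩ | ⟨rfl, rfl⟩) (⟨rfl, rfl⟩ | ⟨rfl, rfl⟩) <;> simp
  left_mem_of_isLink := fun _ _ _ _ => Set.mem_univ _

/-- A (weak) immersion of `H` in `G`: vertices of `H` go to distinct vertices of `G`, and edges of
`H` to pairwise edge-disjoint connected subgraphs of `G` containing the images of their ends; the
image of a loop contains a cycle through the image of its end.
Only the values of `vert` on `V(H)` and of `sub` on `E(H)` are relevant. -/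
structure Immersion {γ δ α β : Type*} (H : Graph γ δ) (G : Graph α β) where
  vert : γ → α
  sub : δ → Graph α β
  vert_mem : ∀ v ∈ H.vertexSet, vert v ∈ G.vertexSet
  vert_injOn : Set.InjOn vert H.vertexSet
  sub_le : ∀ e ∈ H.edgeSet, sub e ≤ G
  sub_connected : ∀ e ∈ H.edgeSet, (sub e).Connected
  edge_disjoint : ∀ e ∈ H.edgeSet, ∀ f ∈ H.edgeSet, e ≠ f →
    Disjoint (sub e).edgeSet (sub f).edgeSet
  vert_mem_sub : ∀ e v, H.Inc e v → vert v ∈ (sub e).vertexSet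
  exists_cycle : ∀ e v, H.IsLoopAt e v → ∃ C ≤ sub e, C.IsCycle ∧ vert v ∈ C.vertexSet

/-- An immersion is strong if the image of an edge contains no image of a vertex that is not
an end of the edge. -/
def Immersion.IsStrong {γ δ α β : Type*} {H : Graph γ δ} {G : Graph α β}
    (θ : Immersion H G) : Prop :=
  ∀ e ∈ H.edgeSet, ∀ v ∈ H.vertexSet, ¬ H.Inc e v → θ.vert v ∉ (θ.sub e).vertexSet

/-- `(H, σ)`, where `c` is the center of `H`, is a `k`-system of magnitude `d` in `G`. -/
structure IsKSystem {γ δ α β : Type*} (k d : ℕ) (H : Graph γ δ) (c : γ) (G : Graph α β)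
    (σ : Immersion H G) : Prop where
  isMultistar : H.IsMultistar c
  isStrong : σ.IsStrong
  le_card_edges : (d : ℕ∞) ≤ H.edgeSet.encard
  degree_le : ∀ v ∈ H.rays c, H.degree v ≤ k
  no_small_cut : ∀ v ∈ H.rays c,
    ¬ ∃ K : Set β, K.encard < k ∧ G.IsEdgeCutSeparating K (σ.vert c) (σ.vert v)

/-- An immersion `θ` of `S_{n,k}` in `G` respects an immersion `σ` of a multistar `H` with center
`c` in `G`: the centers have the same image, and `θ` maps rays to images of rays under `σ`. -/
def Immersion.Respects {γ δ α β : Type*} {n k : ℕ} {H : Graph γ δ} {G : Graph α β}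
    (θ : Immersion (multistar n k) G) (c : γ) (σ : Immersion H G) : Prop :=
  θ.vert none = σ.vert c ∧ θ.vert '' (multistar n k).rays none ⊆ σ.vert '' H.rays c

/-- The function `d(k) = (2k+1)^{8k+4} k^2 (k+1)`. -/
def immersionBound (k : ℕ) : ℕ := (2 * k + 1) ^ (8 * k + 4) * k ^ 2 * (k + 1)

end Graph

/-!
Everything is expressed through edge cuts. Let `c` be the image of the center and `R` the set of
images of the rays; as rays have degree at most `k`, `R` has at least a `1 / k` fraction of the
magnitude. An edge is regarded as two opposite arcs, and the arcs starting in `R' ⊆ R` are removed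
(`avoid`), since walks to `R'` must not pass through `R'`. By Menger's theorem
(`exists_disjoint_trails`), applied after orienting the edges (`Meets.exists_oriented`), the
required immersion with rays in `R'` exists as soon as each set `Y` missing `c` is entered by at
least `k * |R' ∩ Y|` of the remaining arcs (`exists_immersion_of_meets`). The hypotheses say that
each `Y` missing `c` and meeting `R` is entered by at least `k` arcs (`le_card_inArcs`), and, by the
given immersion, that each `Y` missing `c` is entered by at least `|R ∩ Y|` arcs that start outside
`R` (`meets_of_strong_immersion`). A set `R'` as above, linear in `|R|`, is found in three steps, all
of which use that the number of arcs entering a set is submodular.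

* A demand that can be met at all can be met by walks that pass through few vertices of `R`: at most
  as many as there are units of demand (`Meets.exists_avoid_sdiff`). For the demand `k` at one
  `v ∈ R` this gives at most `k` vertices that may block `v`. An independent set `R₀` of this digraph
  of outdegree at most `k` has at least `|R| / (2k + 1)` elements (`exists_independent`), and each
  `v ∈ R₀` can be linked to `c` by `k` walks avoiding the rest of `R₀`.
* Let `R' ⊆ R₀` be maximal such that the cut condition holds. The walks to `R'` can do without all
  but `k |R'|` vertices of `R₀`. If `v` is another vertex of `R₀ \ R'`, then the cut condition for
  `insert v R'` fails at a set containing `v`; the number of arcs entering it exceeds `k` times its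
  number of vertices in `R'` by less than `k` (its `surplus` is less than `k`).
* All these `v` lie in one set `M` that is entered by at most `k ^ k * (k + 1) * |R'|` arcs
  (`exists_cover`), so there are at most that many of them, and `|R₀|` is bounded by a multiple of
  `|R'|`.
-/

namespace ArcCut

/-! ### Arcs entering a set, and demands -/

section Cuts

variable {β V : Type*} [DecidableEq V]

/-- The arcs of `A` that enter `Y`. An arc is a triple `(e, x, y)`: the edge `e`, traversed from
`x` to `y`. -/
def inArcs (A : Finset (β × V × V)) (Y : Finset V) : Finset (β × V × V) :=
  {a ∈ A | a.2.1 ∉ Y ∧ a.2.2 ∈ Y}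

/-- The arcs of `A` that do not start in `R`: walks along them cannot pass through `R`. -/
def avoid (A : Finset (β × V × V)) (R : Finset V) : Finset (β × V × V) :=
  {a ∈ A | a.2.1 ∉ R}

/-- The demand `b` is met by the arcs `A` with source `c`: every set `Y` missing `c` is entered by
at least `b Y` arcs. -/
def Meets (A : Finset (β × V × V)) (c : V) (b : Finset V → ℕ) : Prop :=
  ∀ Y, c ∉ Y → b Y ≤ (inArcs A Y).card

/-- A modular function on finite sets. -/
def Modular (b : Finset V → ℕ) : Prop :=
  ∀ Y Z, b (Y ∪ Z) + b (Y ∩ Z) = b Y + b Z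

variable {A A' : Finset (β × V × V)} {c : V} {R : Finset V} {Y Z : Finset V} {b : Finset V → ℕ}

lemma mem_inArcs {a : β × V × V} : a ∈ inArcs A Y ↔ a ∈ A ∧ a.2.1 ∉ Y ∧ a.2.2 ∈ Y := by
  simp [inArcs]

lemma mem_avoid {a : β × V × V} : a ∈ avoid A R ↔ a ∈ A ∧ a.2.1 ∉ R := by
  simp [avoid]

lemma inArcs_mono (h : A ⊆ A') (Y : Finset V) : inArcs A Y ⊆ inArcs A' Y :=
  Finset.filter_subset_filter _ h

lemma Meets.mono (hb : Meets A c b) (h : A ⊆ A') : Meets A' c b :=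
  fun Y hY => (hb Y hY).trans (Finset.card_le_card (inArcs_mono h Y))

lemma avoid_anti {R S : Finset V} (h : S ⊆ R) : avoid A R ⊆ avoid A S := by
  intro a ha
  rw [mem_avoid] at ha ⊢
  exact ⟨ha.1, fun h' => ha.2 (h h')⟩

lemma modular_card_filter {ι : Type*} [Fintype ι] (t : ι → V) :
    Modular fun Y => (Finset.univ.filter fun i => t i ∈ Y).card := by
  classical
  intro Y Z
  simp only
  rw [← Finset.card_union_add_card_inter (Finset.univ.filter fun i => t i ∈ Y),
    ← Finset.filter_or, ← Finset.filter_and]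
  simp

lemma modular_mul_card_inter (k : ℕ) (R : Finset V) : Modular fun Y => k * (R ∩ Y).card := by
  intro Y Z
  simp only
  rw [← mul_add, ← mul_add, ← Finset.card_union_add_card_inter (R ∩ Y)]
  congr 3 <;> ext i <;> simp <;> tauto

lemma card_inArcs_union_add_inter_le (A : Finset (β × V × V)) (Y Z : Finset V) :
    (inArcs A (Y ∪ Z)).card + (inArcs A (Y ∩ Z)).card ≤
      (inArcs A Y).card + (inArcs A Z).card := by
  classical
  rw [← Finset.card_union_add_card_inter, ← Finset.card_union_add_card_inter (inArcs A Y)]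
  refine add_le_add (Finset.card_le_card fun a => ?_) (Finset.card_le_card fun a => ?_) <;>
  · simp only [Finset.mem_union, Finset.mem_inter, mem_inArcs]
    tauto

/-- A finite union of tight sets of a demand that is met is again tight. -/
lemma Meets.tight_biUnion {ι : Type*} (hb : Meets A c b) (hmod : Modular b) (h0 : b ∅ = 0)
    (s : Finset ι) (Y : ι → Finset V) (hc : ∀ i ∈ s, c ∉ Y i)
    (ht : ∀ i ∈ s, (inArcs A (Y i)).card = b (Y i)) :
    (inArcs A (s.biUnion Y)).card = b (s.biUnion Y) := by
  classical
  induction s using Finset.induction_on with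
  | empty => simp [h0, inArcs]
  | insert i s hi ih =>
    have ih' := ih (fun j hj => hc j (Finset.mem_insert_of_mem hj))
      (fun j hj => ht j (Finset.mem_insert_of_mem hj))
    have hci := hc i (Finset.mem_insert_self _ _)
    have hti := ht i (Finset.mem_insert_self _ _)
    have hcs : c ∉ s.biUnion Y := by
      simp only [Finset.mem_biUnion, not_exists, not_and]
      exact fun j hj => hc j (Finset.mem_insert_of_mem hj)
    rw [Finset.biUnion_insert]
    have h1 := card_inArcs_union_add_inter_le A (Y i) (s.biUnion Y)
    have h2 := hmod (Y i) (s.biUnion Y)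
    have h3 := hb (Y i ∪ s.biUnion Y) (by simp only [Finset.mem_union]; tauto)
    have h4 := hb (Y i ∩ s.biUnion Y) (by simp only [Finset.mem_inter]; tauto)
    omega

/-- If `A` is minimal among the arc sets that meet `b`, then each of its arcs enters a tight
set. -/
lemma exists_tight_of_not_meets_erase [DecidableEq β] {a : β × V × V} (hb : Meets A c b)
    (h : ¬ Meets (A.erase a) c b) :
    ∃ Y, c ∉ Y ∧ a ∈ inArcs A Y ∧ (inArcs A Y).card = b Y := by
  simp only [Meets, not_forall, not_le] at h
  obtain ⟨Y, hcY, hY⟩ := h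
  have h1 := hb Y hcY
  have h2 : inArcs (A.erase a) Y = (inArcs A Y).erase a := by
    ext x; simp only [mem_inArcs, Finset.mem_erase]; tauto
  rw [h2] at hY
  have ha : a ∈ inArcs A Y := by
    by_contra hn
    rw [Finset.erase_eq_of_notMem hn] at hY
    omega
  rw [Finset.card_erase_of_mem ha] at hY
  exact ⟨Y, hcY, ha, by omega⟩

end Cuts

/-! ### Menger's theorem and orientations -/

section Trails

variable {β V : Type*} [DecidableEq β] [DecidableEq V]

/-- `IsTrail c y F`: the arcs in `F` are those of a walk from `c` to `y`. -/
inductive IsTrail (c : V) : V → Finset (β × V × V) → Prop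
  | nil : IsTrail c c ∅
  | snoc {x y : V} {e : β} {F : Finset (β × V × V)} :
      IsTrail c x F → IsTrail c y (insert (e, x, y) F)

/-- **Menger's theorem** for a demand at several vertices: one arc-disjoint walk from `c` to each
`t i`. A unit of demand is moved backwards along an arc that is then deleted; this is possible
unless all arcs into the demand vertex start in a tight set, and then adding that vertex to the
tight set violates the cut condition. -/
theorem exists_disjoint_trails {ι : Type*} [Fintype ι] [DecidableEq ι] {c : V}
    (A : Finset (β × V × V)) (hA : ∀ a ∈ A, a.2.1 ≠ a.2.2) (t : ι → V)
    (h : Meets A c fun Y => (Finset.univ.filter fun i => t i ∈ Y).card) :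
    ∃ F : ι → Finset (β × V × V), (∀ i, IsTrail c (t i) (F i) ∧ F i ⊆ A) ∧
      ∀ i j, i ≠ j → Disjoint (F i) (F j) := by
  induction hn : A.card generalizing A t with
  | zero =>
    rw [Finset.card_eq_zero] at hn
    subst hn
    have ht : ∀ i, t i = c := by
      intro i
      by_contra hi
      have := h {t i} (by simpa using Ne.symm hi)
      simp only [inArcs, Finset.filter_empty, Finset.card_empty, Nat.le_zero, Finset.card_eq_zero,
        Finset.filter_eq_empty_iff] at this
      exact this (Finset.mem_univ i) (by simp)
    exact ⟨fun _ => ∅, fun i => ⟨by rw [ht i]; exact IsTrail.nil, by simp⟩, by simp⟩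
  | succ n ih =>
    by_cases hall : ∀ i, t i = c
    · exact ⟨fun _ => ∅, fun i => ⟨by rw [hall i]; exact IsTrail.nil, by simp⟩, by simp⟩
    push Not at hall
    obtain ⟨i, hi⟩ := hall
    have key : ∃ a ∈ A, a.2.2 = t i ∧ ∀ T, c ∉ T → a.2.1 ∈ T → t i ∉ T →
        (inArcs A T).card ≠ (Finset.univ.filter fun i => t i ∈ T).card := by
      by_contra hno
      push Not at hno
      choose! T hT using hno
      let s := A.filter fun a => a.2.2 = t i
      have hs : ∀ a ∈ s, a ∈ A ∧ a.2.2 = t i := fun a ha => by simpa [s] using ha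
      have htight := h.tight_biUnion (modular_card_filter t) (by simp) s T
        (fun a ha => (hT a (hs a ha).1 (hs a ha).2).1)
        (fun a ha => (hT a (hs a ha).1 (hs a ha).2).2.2.2)
      set U := s.biUnion T with hU
      have hcU : c ∉ U := by
        simp only [hU, Finset.mem_biUnion, not_exists, not_and]
        exact fun a ha => (hT a (hs a ha).1 (hs a ha).2).1
      have hiU : t i ∉ U := by
        simp only [hU, Finset.mem_biUnion, not_exists, not_and]
        exact fun a ha => (hT a (hs a ha).1 (hs a ha).2).2.2.1
      have h1 := h (insert (t i) U) (by
        rw [Finset.mem_insert, not_or]; exact ⟨Ne.symm hi, hcU⟩)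
      have h2 : inArcs A (insert (t i) U) ⊆ inArcs A U := by
        intro a ha
        rw [mem_inArcs] at ha ⊢
        obtain ⟨haA, ha1, ha2⟩ := ha
        rw [Finset.mem_insert, not_or] at ha1
        refine ⟨haA, ha1.2, ?_⟩
        rcases Finset.mem_insert.1 ha2 with h' | h'
        · exact absurd (Finset.mem_biUnion.2 ⟨a, by simp [s, haA, h'], (hT a haA h').2.1⟩) ha1.2
        · exact h'
      have h3 := Finset.card_le_card h2
      have h4 : (Finset.univ.filter fun j => t j ∈ U).card <
          (Finset.univ.filter fun j => t j ∈ insert (t i) U).card := by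
        apply Finset.card_lt_card
        rw [Finset.ssubset_iff_of_subset]
        · exact ⟨i, by simp, by simpa using hiU⟩
        · intro j; simp only [Finset.mem_filter, Finset.mem_insert]; tauto
      simp only at h1
      omega
    obtain ⟨⟨e, x, y⟩, haA, hay, hT⟩ := key
    simp only at hay hT
    subst hay
    have hne : x ≠ t i := hA _ haA
    have hm : Meets (A.erase (e, x, t i)) c
        fun Y => (Finset.univ.filter fun j => Function.update t i x j ∈ Y).card := by
      intro Y hcY
      have h0 := h Y hcY
      have e1 : inArcs (A.erase (e, x, t i)) Y = (inArcs A Y).erase (e, x, t i) := by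
        ext z; simp only [mem_inArcs, Finset.mem_erase]; tauto
      have sp : ∀ f : ι → V, (Finset.univ.filter fun j => f j ∈ Y).card =
          ((Finset.univ.erase i).filter fun j => f j ∈ Y).card + if f i ∈ Y then 1 else 0 := by
        intro f
        conv_lhs => rw [← Finset.insert_erase (Finset.mem_univ i)]
        rw [Finset.filter_insert]
        split_ifs
        · rw [Finset.card_insert_of_notMem (by simp)]
        · rfl
      have e2 : ((Finset.univ.erase i).filter fun j => Function.update t i x j ∈ Y) =
          (Finset.univ.erase i).filter fun j => t j ∈ Y := by
        apply Finset.filter_congr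
        intro j hj
        rw [Function.update_of_ne (Finset.ne_of_mem_erase hj)]
      have h1 := sp t
      have hTY := hT Y hcY
      simp only at h0 ⊢
      rw [sp, e2, Function.update_self, e1]
      by_cases hx : x ∈ Y <;> by_cases hy : t i ∈ Y
      · rw [Finset.erase_eq_of_notMem (s := inArcs A Y) (by simp [mem_inArcs, hx]), if_pos hx]
        rw [if_pos hy] at h1
        omega
      · rw [Finset.erase_eq_of_notMem (s := inArcs A Y) (by simp [mem_inArcs, hx]), if_pos hx]
        rw [if_neg hy] at h1
        have := hTY hx hy
        omega
      · rw [Finset.card_erase_of_mem (by simp [mem_inArcs, hx, hy, haA]), if_neg hx]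
        rw [if_pos hy] at h1
        omega
      · rw [Finset.erase_eq_of_notMem (s := inArcs A Y) (by simp [mem_inArcs, hy]), if_neg hx]
        rw [if_neg hy] at h1
        omega
    obtain ⟨F, hF, hd⟩ := ih (A.erase (e, x, t i)) (fun a ha => hA a (Finset.mem_of_mem_erase ha))
      (Function.update t i x) hm (by rw [Finset.card_erase_of_mem haA]; omega)
    have hnot : ∀ j, (e, x, t i) ∉ F j := fun j hj =>
      Finset.notMem_erase _ _ ((hF j).2 hj)
    refine ⟨Function.update F i (insert (e, x, t i) (F i)), fun j => ?_, fun j l hjl => ?_⟩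
    · by_cases hj : j = i
      · subst hj
        have := hF j
        rw [Function.update_self] at this ⊢
        exact ⟨this.1.snoc, Finset.insert_subset haA (this.2.trans (Finset.erase_subset _ _))⟩
      · have := hF j
        rw [Function.update_of_ne hj] at this ⊢
        exact ⟨this.1, this.2.trans (Finset.erase_subset _ _)⟩
    · by_cases hj : j = i
      · subst hj
        rw [Function.update_self, Function.update_of_ne (Ne.symm hjl), Finset.disjoint_insert_left]
        exact ⟨hnot l, hd _ _ hjl⟩
      · rw [Function.update_of_ne hj]
        by_cases hl : l = i
        · subst hl
          rw [Function.update_self, Finset.disjoint_insert_right]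
          exact ⟨hnot j, hd _ _ hjl⟩
        · rw [Function.update_of_ne hl]
          exact hd _ _ hjl

/-- An arc set that meets a modular demand contains one that meets it and has no two opposite arcs:
in a minimal one, opposite arcs would enter two tight sets whose uncrossing loses both arcs. -/
lemma Meets.exists_oriented {A : Finset (β × V × V)} {c : V} {b : Finset V → ℕ}
    (hb : Meets A c b) (hmod : Modular b) :
    ∃ B ⊆ A, Meets B c b ∧ ∀ e f x y, (e, x, y) ∈ B → (f, y, x) ∉ B := by
  obtain ⟨B, hBA, hB⟩ := exists_minimal_le_of_wellFoundedLT (fun B => Meets B c b) A hb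
  refine ⟨B, hBA, hB.prop, fun e f x y h1 h2 => ?_⟩
  have hmin : ∀ a ∈ B, ¬ Meets (B.erase a) c b := fun a ha hm =>
    Finset.notMem_erase a B (hB.le_of_le hm (Finset.erase_subset _ _) ha)
  obtain ⟨Y, hcY, haY, hY⟩ := exists_tight_of_not_meets_erase hB.prop (hmin _ h1)
  obtain ⟨Z, hcZ, haZ, hZ⟩ := exists_tight_of_not_meets_erase hB.prop (hmin _ h2)
  rw [mem_inArcs] at haY haZ
  simp only at haY haZ
  have s := card_inArcs_union_add_inter_le (B.erase (e, x, y)) Y Z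
  have er : ∀ W, inArcs (B.erase (e, x, y)) W = (inArcs B W).erase (e, x, y) := by
    intro W; ext z; simp only [mem_inArcs, Finset.mem_erase]; tauto
  simp only [er] at s
  rw [Finset.erase_eq_of_notMem (s := inArcs B (Y ∪ Z)) (by simp [mem_inArcs, haZ.2.2]),
    Finset.erase_eq_of_notMem (s := inArcs B (Y ∩ Z)) (by simp [mem_inArcs, haZ.2.1]),
    Finset.erase_eq_of_notMem (s := inArcs B Z) (by simp [mem_inArcs, haZ.2.1]),
    Finset.card_erase_of_mem (by simp [mem_inArcs, haY])] at s
  have h3 := hB.prop (Y ∪ Z) (by simp only [Finset.mem_union]; tauto)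
  have h4 := hB.prop (Y ∩ Z) (by simp only [Finset.mem_inter]; tauto)
  have h5 := hmod Y Z
  have h6 : 0 < (inArcs B Y).card := Finset.card_pos.2 ⟨_, mem_inArcs.2 haY⟩
  omega

end Trails

/-! ### Walks that avoid most of a given vertex set -/

section Blocking

variable {β V : Type*} [DecidableEq β] [DecidableEq V]

/-- Walks that meet a demand `b` need to pass through few vertices of `R`, provided that disjoint
walks to all of `R`, each meeting `R` only in its end, exist. Take a minimal set `F` of arcs leaving
`R` that has to be kept: each arc of `F` enters a tight set, and in the union `U` of these tight
sets, every starting vertex of `F` either lies in `R ∩ U` or starts an arc of `F` that enters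
`U`. -/
lemma Meets.exists_avoid_sdiff {A : Finset (β × V × V)} {c : V} {R : Finset V}
    {b : Finset V → ℕ} {N : ℕ} (hb : Meets A c b) (hmod : Modular b) (h0 : b ∅ = 0)
    (hN : ∀ Y, b Y ≤ N) (hR : Meets (avoid A R) c fun Y => (R ∩ Y).card) :
    ∃ S : Finset V, S.card ≤ N ∧ Meets (avoid A (R \ S)) c b := by
  have htop : Meets (avoid A R ∪ A.filter fun a => a.2.1 ∈ R) c b := by
    refine hb.mono fun a ha => ?_
    simp only [Finset.mem_union, mem_avoid, Finset.mem_filter]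
    tauto
  obtain ⟨F, hF, hFmin⟩ := exists_minimal_le_of_wellFoundedLT
    (fun F => Meets (avoid A R ∪ F) c b) (A.filter fun a => a.2.1 ∈ R) htop
  have hF' : ∀ a ∈ F, a ∈ A ∧ a.2.1 ∈ R := fun a ha => by simpa using hF ha
  have htight : ∀ a ∈ F, ∃ Y, c ∉ Y ∧ a ∈ inArcs (avoid A R ∪ F) Y ∧
      (inArcs (avoid A R ∪ F) Y).card = b Y := by
    intro a ha
    refine exists_tight_of_not_meets_erase hFmin.prop fun hm => ?_
    have : (avoid A R ∪ F).erase a = avoid A R ∪ F.erase a := by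
      rw [Finset.erase_union_distrib, Finset.erase_eq_of_notMem (s := avoid A R)]
      simp [mem_avoid, (hF' a ha).2]
    rw [this] at hm
    exact Finset.notMem_erase a F (hFmin.le_of_le hm (Finset.erase_subset _ _) ha)
  choose! Y hY using htight
  have hU := hFmin.prop.tight_biUnion hmod h0 F Y (fun a ha => (hY a ha).1)
    (fun a ha => (hY a ha).2.2)
  set U := F.biUnion Y with hUdef
  have hcU : c ∉ U := by
    simp only [hUdef, Finset.mem_biUnion, not_exists, not_and]
    exact fun a ha => (hY a ha).1
  refine ⟨F.image fun a => a.2.1, ?_, ?_⟩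
  · have hsub : (F.image fun a => a.2.1) ⊆ (R ∩ U) ∪ (inArcs F U).image fun a => a.2.1 := by
      intro x hx
      obtain ⟨a, ha, rfl⟩ := Finset.mem_image.1 hx
      by_cases hxU : a.2.1 ∈ U
      · exact Finset.mem_union_left _ (Finset.mem_inter.2 ⟨(hF' a ha).2, hxU⟩)
      · refine Finset.mem_union_right _ (Finset.mem_image_of_mem _ (mem_inArcs.2 ⟨ha, hxU, ?_⟩))
        exact Finset.mem_biUnion.2 ⟨a, ha, (mem_inArcs.1 (hY a ha).2.1).2.2⟩
    have h1 := (Finset.card_le_card hsub).trans (Finset.card_union_le _ _)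
    have h2 : ((inArcs F U).image fun a => a.2.1).card ≤ (inArcs F U).card :=
      Finset.card_image_le
    have h3 := hR U hcU
    have h4 : (inArcs (avoid A R ∪ F) U).card =
        (inArcs (avoid A R) U).card + (inArcs F U).card := by
      rw [← Finset.card_union_of_disjoint]
      · congr 1
        exact Finset.filter_union _ _ _
      · rw [Finset.disjoint_left]
        intro a ha ha'
        exact (mem_avoid.1 (mem_inArcs.1 ha).1).2 (hF' a (mem_inArcs.1 ha').1).2
    have h5 := hN U
    simp only at h3
    omega
  · refine hFmin.prop.mono fun a ha => ?_
    rw [mem_avoid, Finset.mem_sdiff]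
    rcases Finset.mem_union.1 ha with ha | ha
    · rw [mem_avoid] at ha
      exact ⟨ha.1, fun h => ha.2 h.1⟩
    · exact ⟨(hF' a ha).1, fun h => h.2 (Finset.mem_image_of_mem _ ha)⟩

end Blocking

/-! ### Independent sets in digraphs of bounded outdegree -/

section Independent

/-- A digraph in which every out-neighbourhood `S v` has at most `k` elements has a large
independent set: some vertex has at most `k` in-neighbours; choose it, and delete it together with
its neighbours. -/
lemma exists_independent {V : Type*} [DecidableEq V] (k : ℕ) (S : V → Finset V) (R : Finset V)
    (hS : ∀ v ∈ R, (S v).card ≤ k) :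
    ∃ R₀ ⊆ R, R.card ≤ (2 * k + 1) * R₀.card ∧ ∀ v ∈ R₀, ∀ w ∈ R₀, v ≠ w → w ∉ S v := by
  induction R using Finset.strongInduction with
  | H R ih =>
    rcases R.eq_empty_or_nonempty with rfl | hne
    · exact ⟨∅, by simp⟩
    obtain ⟨v, hv, hin⟩ : ∃ v ∈ R, (R.filter fun w => v ∈ S w).card ≤ k := by
      refine Finset.exists_le_of_sum_le hne (f := fun v => (R.filter fun w => v ∈ S w).card)
        (g := fun _ => k) ?_
      have := Finset.sum_card_bipartiteAbove_eq_sum_card_bipartiteBelow (s := R) (t := R)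
        (fun v w => v ∈ S w)
      simp only [Finset.bipartiteAbove, Finset.bipartiteBelow] at this
      rw [this]
      refine Finset.sum_le_sum fun w hw => le_trans (Finset.card_le_card fun x hx => ?_) (hS w hw)
      exact (Finset.mem_filter.1 hx).2
    set D := insert v (S v ∪ R.filter fun w => v ∈ S w) with hD
    obtain ⟨R₀, hR₀, hcard, hind⟩ := ih (R \ D)
      ((Finset.ssubset_iff_of_subset Finset.sdiff_subset).2 ⟨v, hv, by simp [hD]⟩)
      (fun w hw => hS w (Finset.mem_sdiff.1 hw).1)
    have hvR₀ : v ∉ R₀ := fun h => by simpa [hD] using hR₀ h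
    have hD' : D.card ≤ 2 * k + 1 := by
      have h1 := Finset.card_insert_le v (S v ∪ R.filter fun w => v ∈ S w)
      have h2 := Finset.card_union_le (S v) (R.filter fun w => v ∈ S w)
      have h3 := hS v hv
      rw [hD]
      omega
    refine ⟨insert v R₀, Finset.insert_subset hv (hR₀.trans Finset.sdiff_subset), ?_, ?_⟩
    · have h1 := Finset.card_le_card_sdiff_add_card (s := R) (t := D)
      rw [Finset.card_insert_of_notMem hvR₀, mul_add, mul_one]
      omega
    · have hout : ∀ w ∈ R₀, w ∉ S v ∧ v ∉ S w := by
        intro w hw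
        have := hR₀ hw
        simp only [hD, Finset.mem_sdiff, Finset.mem_insert, Finset.mem_union, Finset.mem_filter,
          not_or, not_and] at this
        exact ⟨this.2.2.1, this.2.2.2 this.1⟩
      intro x hx y hy hxy
      rcases Finset.mem_insert.1 hx with rfl | hx' <;> rcases Finset.mem_insert.1 hy with rfl | hy'
      · exact absurd rfl hxy
      · exact (hout y hy').1
      · exact (hout x hx').2
      · exact hind x hx' y hy' hxy

end Independent

/-! ### Covering by sets of small surplus -/

section Selection

variable {β V : Type*} [DecidableEq V]

/-- The surplus of arcs of `A` entering `Y` over `k` times the number of vertices of `R` in `Y`. -/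
def surplus (A : Finset (β × V × V)) (k : ℕ) (R Y : Finset V) : ℤ :=
  (inArcs A Y).card - k * (R ∩ Y).card

lemma surplus_union_add_inter_le (A : Finset (β × V × V)) (k : ℕ) (R Y Z : Finset V) :
    surplus A k R (Y ∪ Z) + surplus A k R (Y ∩ Z) ≤ surplus A k R Y + surplus A k R Z := by
  have h1 := card_inArcs_union_add_inter_le A Y Z
  have h2 := modular_mul_card_inter k R Y Z
  simp only [surplus]
  zify at h1 h2
  linarith

lemma surplus_biUnion_le {A : Finset (β × V × V)} {k : ℕ} {R M : Finset V} {c : V} {q : ℤ}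
    (hM : ∀ X, M ⊆ X → c ∉ X → surplus A k R M ≤ surplus A k R X)
    {ι : Type*} [DecidableEq ι] (s : Finset ι) (C : ι → Finset V) (hMC : ∀ i ∈ s, M ⊆ C i)
    (hcC : ∀ i ∈ s, c ∉ C i)
    (hC : ∀ i ∈ s, surplus A k R (C i) ≤ surplus A k R M + q) :
    surplus A k R (M ∪ s.biUnion C) ≤ surplus A k R M + s.card * q := by
  induction s using Finset.induction_on with
  | empty => simp
  | insert i s hi ih =>
    have ih' := ih (fun j hj => hMC j (Finset.mem_insert_of_mem hj))
      (fun j hj => hcC j (Finset.mem_insert_of_mem hj))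
      (fun j hj => hC j (Finset.mem_insert_of_mem hj))
    have hi' := Finset.mem_insert_self i s
    have h1 := surplus_union_add_inter_le A k R (M ∪ s.biUnion C) (C i)
    have h2 := hM ((M ∪ s.biUnion C) ∩ C i)
      (Finset.subset_inter Finset.subset_union_left (hMC i hi'))
      (fun h => hcC i hi' (Finset.mem_inter.1 h).2)
    have h3 := hC i hi'
    have h4 : M ∪ (insert i s).biUnion C = (M ∪ s.biUnion C) ∪ C i := by
      rw [Finset.biUnion_insert, Finset.union_assoc, Finset.union_comm (C i)]
    rw [h4, Finset.card_insert_of_notMem hi]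
    push_cast
    linarith

/-- Every set missing `c` can be enlarged, without increasing its surplus, to a set all of whose
proper enlargements have larger surplus. -/
lemma exists_surplus_closed [Finite V] (A : Finset (β × V × V)) (k : ℕ) (R : Finset V) {c : V}
    {M : Finset V} (hcM : c ∉ M) :
    ∃ M' : Finset V, M ⊆ M' ∧ c ∉ M' ∧ surplus A k R M' ≤ surplus A k R M ∧
      ∀ X, M' ⊂ X → c ∉ X → surplus A k R M' < surplus A k R X := by
  obtain ⟨M', hMM', hM'⟩ := Finite.exists_le_maximal
    (p := fun X : Finset V => c ∉ X ∧ surplus A k R X ≤ surplus A k R M) ⟨hcM, le_rfl⟩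
  refine ⟨M', hMM', hM'.prop.1, hM'.prop.2, fun X hX hcX => ?_⟩
  by_contra hn
  push Not at hn
  exact hX.not_subset (hM'.le_of_ge ⟨hcX, hn.trans hM'.prop.2⟩ hX.subset)

/-- Let `A` consist of the arcs of a symmetric arc set that do not start in `R`. Any set `X ⊇ M`
that contains a new vertex `v ∉ R`, which is `k`-connected from `c` within `A`, and whose surplus
exceeds that of `M` by less than `k`, contains a new vertex that lies in `R` or starts an arc into
`M`: otherwise there are no arcs between `M` and `X \ M`. -/
lemma exists_seed {A₀ : Finset (β × V × V)} {k : ℕ} {R M X : Finset V} {c v : V}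
    (hsymm : ∀ e x y, (e, x, y) ∈ A₀ → (e, y, x) ∈ A₀)
    (hv : ∀ Y, c ∉ Y → v ∈ Y → Disjoint R Y → k ≤ (inArcs (avoid A₀ R) Y).card)
    (hMX : M ⊆ X) (hcX : c ∉ X) (hvX : v ∈ X) (hvM : v ∉ M)
    (hX : surplus (avoid A₀ R) k R X < surplus (avoid A₀ R) k R M + k) :
    ∃ z ∈ X, z ∉ M ∧ (z ∈ R ∨ ∃ a ∈ inArcs (avoid A₀ R) M, a.2.1 = z) := by
  classical
  by_contra hno
  push Not at hno
  have hdisj : Disjoint R (X \ M) := by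
    rw [Finset.disjoint_right]
    intro z hz
    rw [Finset.mem_sdiff] at hz
    exact (hno z hz.1 hz.2).1
  have hk := hv (X \ M) (fun h => hcX (Finset.mem_sdiff.1 h).1) (Finset.mem_sdiff.2 ⟨hvX, hvM⟩)
    hdisj
  have hR : R ∩ X = R ∩ M := by
    ext z
    simp only [Finset.mem_inter, and_congr_right_iff]
    intro hzR
    exact ⟨fun hzX => by_contra fun hzM => (hno z hzX hzM).1 hzR, fun h => hMX h⟩
  have hsub : inArcs (avoid A₀ R) M ∪ inArcs (avoid A₀ R) (X \ M) ⊆ inArcs (avoid A₀ R) X := by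
    rintro ⟨e, x, y⟩ ha
    rcases Finset.mem_union.1 ha with ha | ha
    · have ha' := mem_inArcs.1 ha
      refine mem_inArcs.2 ⟨ha'.1, fun hx => ?_, hMX ha'.2.2⟩
      exact (hno x hx ha'.2.1).2 _ ha rfl
    · obtain ⟨haA, hx, hy⟩ := mem_inArcs.1 ha
      simp only [Finset.mem_sdiff] at hx hy
      refine mem_inArcs.2 ⟨haA, fun hxX => ?_, hy.1⟩
      have hxM : x ∈ M := by
        by_contra h
        exact hx ⟨hxX, h⟩
      refine (hno y hy.1 hy.2).2 (e, y, x) (mem_inArcs.2 ⟨?_, hy.2, hxM⟩) rfl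
      exact mem_avoid.2 ⟨hsymm _ _ _ (mem_avoid.1 haA).1, (hno y hy.1 hy.2).1⟩
  have hcard := Finset.card_le_card hsub
  rw [Finset.card_union_of_disjoint] at hcard
  · simp only [surplus, hR] at hX
    zify at hcard hk
    linarith
  · rw [Finset.disjoint_left]
    intro a ha ha'
    exact (Finset.mem_sdiff.1 (mem_inArcs.1 ha').2.2).2 (mem_inArcs.1 ha).2.2

/-- Suppose that every set `Y` missing `c` is entered by `k * |R ∩ Y|` arcs, that every vertex of
`T` is `k`-connected from `c` by walks avoiding `R`, and that each `v ∈ T` lies in a set of surplus less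
than `k`. Then a set with few entering arcs covers `T`.
The covering set grows in rounds. In each round, a set of small surplus through each seed of
`exists_seed` is added, and the result is closed by `exists_surplus_closed`. A set of small surplus
that contains an uncovered `v` shares a seed with what is added, so by submodularity its excess
over the surplus of the covering set drops in each round. -/
lemma exists_cover [Finite V] {A₀ : Finset (β × V × V)} {k : ℕ} (hk : 1 ≤ k) {R T : Finset V} {c : V}
    (hsymm : ∀ e x y, (e, x, y) ∈ A₀ → (e, y, x) ∈ A₀)
    (hR : Meets (avoid A₀ R) c fun Y => k * (R ∩ Y).card)
    (hT : ∀ v ∈ T, ∀ Y, c ∉ Y → v ∈ Y → Disjoint R Y → k ≤ (inArcs (avoid A₀ R) Y).card)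
    (hT' : ∀ v ∈ T, ∃ Y, c ∉ Y ∧ v ∈ Y ∧ surplus (avoid A₀ R) k R Y < k) :
    ∃ M, c ∉ M ∧ T ⊆ M ∧ (inArcs (avoid A₀ R) M).card ≤ k ^ k * ((k + 1) * R.card) := by
  classical
  set A := avoid A₀ R with hA
  have hpos : ∀ Y, c ∉ Y → 0 ≤ surplus A k R Y := by
    intro Y hY
    have := hR Y hY
    simp only [surplus]
    zify at this
    linarith
  have rounds : ∀ j : ℕ, ∃ M, c ∉ M ∧ (∀ X, M ⊂ X → c ∉ X → surplus A k R M < surplus A k R X) ∧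
      (∀ v ∈ T, v ∉ M → ∃ X, M ⊆ X ∧ c ∉ X ∧ v ∈ X ∧
        surplus A k R X + j < surplus A k R M + k) ∧
      surplus A k R M + (k + 1) * R.card ≤ k ^ j * ((k + 1) * R.card) := by
    intro j
    induction j with
    | zero =>
      obtain ⟨M, -, hcM, hM0, hM⟩ := exists_surplus_closed A k R (c := c) (M := ∅) (by simp)
      have h0 : surplus A k R ∅ = 0 := by simp [surplus, inArcs]
      refine ⟨M, hcM, hM, fun v hv hvM => ?_, by simp; linarith⟩
      obtain ⟨Y, hcY, hvY, hY⟩ := hT' v hv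
      refine ⟨Y ∪ M, Finset.subset_union_right, by simp [hcY, hcM], by simp [hvY], ?_⟩
      have h1 := surplus_union_add_inter_le A k R Y M
      have h2 := hpos (Y ∩ M) (by simp [hcY])
      push_cast
      linarith
    | succ j ih =>
      obtain ⟨M, hcM, hM, hcov, hbound⟩ := ih
      have hM' : ∀ X, M ⊆ X → c ∉ X → surplus A k R M ≤ surplus A k R X := by
        intro X hX hcX
        rcases hX.eq_or_ssubset with rfl | h
        · exact le_rfl
        · exact (hM X h hcX).le
      let seeds := R ∪ (inArcs A M).image fun a => a.2.1
      let C : V → Finset V := fun z =>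
        if h : ∃ X, M ⊆ X ∧ c ∉ X ∧ z ∈ X ∧ surplus A k R X < surplus A k R M + k
        then h.choose else M
      have hC : ∀ z, M ⊆ C z ∧ c ∉ C z ∧ surplus A k R (C z) ≤ surplus A k R M + (k - 1) := by
        intro z
        by_cases h : ∃ X, M ⊆ X ∧ c ∉ X ∧ z ∈ X ∧ surplus A k R X < surplus A k R M + k
        · have hz : C z = h.choose := dif_pos h
          have := h.choose_spec
          rw [hz]
          exact ⟨this.1, this.2.1, by linarith [Int.add_one_le_iff.2 this.2.2.2]⟩
        · have hz : C z = M := dif_neg h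
          rw [hz]
          have : (1 : ℤ) ≤ k := by exact_mod_cast hk
          exact ⟨subset_rfl, hcM, by linarith⟩
      have h1 := surplus_biUnion_le hM' seeds C (fun z _ => (hC z).1) (fun z _ => (hC z).2.1)
        (fun z _ => (hC z).2.2)
      have hcM1 : c ∉ M ∪ seeds.biUnion C := by
        simp only [Finset.mem_union, Finset.mem_biUnion, not_or, not_exists, not_and]
        exact ⟨hcM, fun z _ => (hC z).2.1⟩
      obtain ⟨M', hMM', hcM', hle, hclosed⟩ := exists_surplus_closed A k R hcM1
      refine ⟨M', hcM', hclosed, fun v hv hvM' => ?_, ?_⟩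
      · have hvM : v ∉ M := fun h => hvM' (hMM' (Finset.mem_union_left _ h))
        obtain ⟨X, hMX, hcX, hvX, hX⟩ := hcov v hv hvM
        have hX' : surplus A k R X < surplus A k R M + k := by
          have : (0 : ℤ) ≤ j := by positivity
          linarith
        obtain ⟨z, hzX, hzM, hz⟩ := exists_seed hsymm (hT v hv) hMX hcX hvX hvM hX'
        have hzs : z ∈ seeds := by
          rcases hz with h | ⟨a, ha, rfl⟩
          · exact Finset.mem_union_left _ h
          · exact Finset.mem_union_right _ (Finset.mem_image_of_mem _ ha)
        have hzC : z ∈ C z := by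
          have h : ∃ X, M ⊆ X ∧ c ∉ X ∧ z ∈ X ∧ surplus A k R X < surplus A k R M + k :=
            ⟨X, hMX, hcX, hzX, hX'⟩
          have hz : C z = h.choose := dif_pos h
          rw [hz]
          exact h.choose_spec.2.2.1
        have hzM' : z ∈ M' :=
          hMM' (Finset.mem_union_right _ (Finset.mem_biUnion.2 ⟨z, hzs, hzC⟩))
        refine ⟨X ∪ M', Finset.subset_union_right, by simp [hcX, hcM'], by simp [hvX], ?_⟩
        have h2 := surplus_union_add_inter_le A k R X M'
        have h3 := hM (X ∩ M') ((Finset.ssubset_iff_of_subset (Finset.subset_inter hMX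
          (Finset.subset_union_left.trans hMM'))).2 ⟨z, Finset.mem_inter.2 ⟨hzX, hzM'⟩, hzM⟩)
          (by simp [hcX])
        push_cast
        linarith [Int.add_one_le_iff.2 h3]
      · have hs : (seeds.card : ℤ) ≤ R.card + (surplus A k R M + k * R.card) := by
          have e1 : seeds.card ≤ R.card + (inArcs A M).card :=
            (Finset.card_union_le _ _).trans (Nat.add_le_add_left Finset.card_image_le _)
          have e2 : (R ∩ M).card ≤ R.card := Finset.card_le_card Finset.inter_subset_left
          have e3 : (k : ℤ) * (R ∩ M).card ≤ k * R.card := by exact_mod_cast Nat.mul_le_mul_left k e2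
          simp only [surplus]
          zify at e1
          linarith
        have hk' : (0 : ℤ) ≤ k - 1 := by
          have : (1 : ℤ) ≤ k := by exact_mod_cast hk
          linarith
        have h4 := mul_le_mul_of_nonneg_right hs hk'
        have h5 := mul_le_mul_of_nonneg_left hbound (Int.natCast_nonneg k)
        rw [pow_succ]
        nlinarith
  obtain ⟨M, hcM, hM, hcov, hbound⟩ := rounds k
  refine ⟨M, hcM, fun v hv => ?_, ?_⟩
  · by_contra hvM
    obtain ⟨X, hMX, hcX, hvX, hX⟩ := hcov v hv hvM
    have hss : M ⊂ X := (Finset.ssubset_iff_of_subset hMX).2 ⟨v, hvX, hvM⟩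
    linarith [hM X hss hcX]
  · have e2 : (R ∩ M).card ≤ R.card := Finset.card_le_card Finset.inter_subset_left
    have e3 : (k : ℤ) * (R ∩ M).card ≤ k * R.card := by exact_mod_cast Nat.mul_le_mul_left k e2
    simp only [surplus] at hbound
    have e4 : (0 : ℤ) ≤ R.card := by positivity
    zify
    linarith

end Selection

/-! ### Selecting vertices that can be linked simultaneously -/

section Main

variable {β V : Type*} [DecidableEq β] [DecidableEq V] [Finite V]

/-- Among the vertices of `R` a linear number can be linked to `c` by `k` disjoint walks each, none
of which passes through another chosen vertex. -/
theorem exists_linked_subset {A₀ : Finset (β × V × V)} {k : ℕ} (hk : 1 ≤ k) {R : Finset V} {c : V}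
    (hsymm : ∀ e x y, (e, x, y) ∈ A₀ → (e, y, x) ∈ A₀)
    (hconn : ∀ v ∈ R, ∀ Y, c ∉ Y → v ∈ Y → k ≤ (inArcs A₀ Y).card)
    (hR : Meets (avoid A₀ R) c fun Y => (R ∩ Y).card) :
    ∃ R' ⊆ R, R.card ≤ (2 * k + 1) * ((k + 1) * (k ^ k + 1) * R'.card) ∧
      Meets (avoid A₀ R') c fun Y => k * (R' ∩ Y).card := by
  have hS : ∀ v ∈ R, ∃ S : Finset V, S.card ≤ k ∧
      Meets (avoid A₀ (R \ S)) c fun Y => k * ({v} ∩ Y).card := by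
    intro v hv
    refine Meets.exists_avoid_sdiff (fun Y hcY => ?_) (modular_mul_card_inter k {v}) (by simp)
      (fun Y => ?_) hR
    · by_cases hvY : v ∈ Y
      · simpa [Finset.singleton_inter_of_mem hvY] using hconn v hv Y hcY hvY
      · simp [Finset.singleton_inter_of_notMem hvY]
    · have : ({v} ∩ Y).card ≤ 1 :=
        (Finset.card_le_card Finset.inter_subset_left).trans (by simp)
      nlinarith
  choose! S hSk hSm using hS
  obtain ⟨R₀, hR₀, hcard, hind⟩ := exists_independent k S R hSk
  have hT : ∀ v ∈ R₀, ∀ Y, c ∉ Y → v ∈ Y → ∀ Q ⊆ R₀, k ≤ (inArcs (avoid A₀ Q) Y).card := by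
    intro v hv Y hcY hvY Q hQ
    have h1 := hSm v (hR₀ hv) Y hcY
    simp only [Finset.singleton_inter_of_mem hvY, Finset.card_singleton, mul_one] at h1
    refine h1.trans (Finset.card_le_card fun a ha => ?_)
    obtain ⟨haA, ha1, ha2⟩ := mem_inArcs.1 ha
    rw [mem_avoid, Finset.mem_sdiff] at haA
    refine mem_inArcs.2 ⟨mem_avoid.2 ⟨haA.1, fun h => haA.2 ⟨hR₀ (hQ h), ?_⟩⟩, ha1, ha2⟩
    refine hind v hv _ (hQ h) ?_
    rintro rfl
    exact ha1 hvY
  obtain ⟨R', -, hR'⟩ := Finite.exists_le_maximal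
    (p := fun Q : Finset V => Q ⊆ R₀ ∧ Meets (avoid A₀ Q) c fun Y => k * (Q ∩ Y).card)
    (a := ∅) ⟨by simp, fun Y _ => by simp⟩
  obtain ⟨hR'sub, hR'm⟩ := hR'.prop
  obtain ⟨P, hP, hPm⟩ := hR'm.exists_avoid_sdiff (R := R₀) (modular_mul_card_inter k R') (by simp)
    (fun Y => Nat.mul_le_mul_left k (Finset.card_le_card Finset.inter_subset_left)) (by
      intro Y hcY
      refine (Finset.card_le_card (Finset.inter_subset_inter_right hR₀)).trans
        ((hR Y hcY).trans (Finset.card_le_card (inArcs_mono (fun a ha => ?_) Y)))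
      rw [mem_avoid] at ha
      exact mem_avoid.2 ⟨mem_avoid.2 ⟨ha.1, fun h => ha.2 (hR₀ (hR'sub h))⟩,
        fun h => ha.2 (hR₀ h)⟩)
  obtain ⟨M, hcM, hTM, hM⟩ := exists_cover hk (R := R') (T := R₀ \ (R' ∪ P)) hsymm hR'm
    (fun v hv Y hcY hvY _ => hT v (Finset.mem_sdiff.1 hv).1 Y hcY hvY R' hR'sub) (by
      intro v hv
      simp only [Finset.mem_sdiff, Finset.mem_union, not_or] at hv
      obtain ⟨hvR₀, hvR', hvP⟩ := hv
      -- `R'` is maximal, so `insert v R'` violates the cut condition at some `Y`; as the walks to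
      -- `R'` can do without `v`, this `Y` contains `v`.
      have hnot : ¬ Meets (avoid A₀ (insert v R')) c fun Y => k * (insert v R' ∩ Y).card :=
        fun hm => hvR' (hR'.le_of_ge ⟨Finset.insert_subset hvR₀ hR'sub, hm⟩
          (Finset.subset_insert _ _) (Finset.mem_insert_self _ _))
      simp only [Meets, not_forall, not_le] at hnot
      obtain ⟨Y, hcY, hY⟩ := hnot
      have hvY : v ∈ Y := by
        by_contra hvY
        rw [Finset.insert_inter_of_notMem hvY] at hY
        refine absurd ((hPm Y hcY).trans (Finset.card_le_card (inArcs_mono (fun a ha => ?_) Y)))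
          (not_le.2 hY)
        simp only [mem_avoid, Finset.mem_sdiff, Finset.mem_insert, not_or] at ha ⊢
        refine ⟨ha.1.1, fun h => ha.2 ?_, ha.1.2⟩
        rw [h]
        exact ⟨hvR₀, hvP⟩
      refine ⟨Y, hcY, hvY, ?_⟩
      have h1 : (inArcs (avoid A₀ R') Y).card ≤ (inArcs (avoid A₀ (insert v R')) Y).card := by
        refine Finset.card_le_card fun a ha => ?_
        obtain ⟨haA, ha1, ha2⟩ := mem_inArcs.1 ha
        rw [mem_avoid] at haA
        refine mem_inArcs.2 ⟨mem_avoid.2 ⟨haA.1, ?_⟩, ha1, ha2⟩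
        rw [Finset.mem_insert, not_or]
        refine ⟨?_, haA.2⟩
        rintro h
        exact ha1 (h ▸ hvY)
      rw [Finset.insert_inter_of_mem hvY, Finset.card_insert_of_notMem
        (fun h => hvR' (Finset.mem_inter.1 h).1), mul_add, mul_one] at hY
      simp only [surplus]
      zify at h1 hY
      linarith)
  refine ⟨R', hR'sub.trans hR₀, hcard.trans (Nat.mul_le_mul_left _ ?_), hR'm⟩
  have h1 : (R₀ \ (R' ∪ P)).card ≤ (inArcs (avoid A₀ R') M).card := by
    refine (Finset.card_le_card fun v hv => ?_).trans
      ((hR M hcM).trans (Finset.card_le_card (inArcs_mono (avoid_anti (hR'sub.trans hR₀)) M)))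
    exact Finset.mem_inter.2 ⟨hR₀ (Finset.mem_sdiff.1 hv).1, hTM hv⟩
  have h2 := Finset.card_le_card_sdiff_add_card (s := R₀) (t := R' ∪ P)
  have h3 := Finset.card_union_le R' P
  have h4 : (k + 1) * (k ^ k + 1) * R'.card =
      k ^ k * ((k + 1) * R'.card) + k * R'.card + R'.card := by ring
  omega

end Main

/-! ### From arc sets to subgraphs -/

section Graphs

variable {α β : Type*} {G : Graph α β}

lemma exists_isLink_of_reachable {K : Graph α β} {x y : α} (h : K.Reachable x y) {Y : Set α}
    (hx : x ∉ Y) (hy : y ∈ Y) : ∃ e a b, K.IsLink e a b ∧ a ∉ Y ∧ b ∈ Y := by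
  induction h with
  | refl => exact absurd hy hx
  | @tail b d _ hbd ih =>
    by_cases hb : b ∈ Y
    · exact ih hb
    · obtain ⟨e, he⟩ := hbd
      exact ⟨e, b, d, he, hb, hy⟩

/-- The arcs of `G`: both orientations of each edge that is not a loop. -/
def arcSet (G : Graph α β) : Set (β × G.vertexSet × G.vertexSet) :=
  {a | G.IsLink a.1 a.2.1 a.2.2 ∧ a.2.1 ≠ a.2.2}

lemma arcSet_finite (hV : G.vertexSet.Finite) (hE : G.edgeSet.Finite) : (arcSet G).Finite := by
  have : Finite G.vertexSet := hV
  exact (hE.prod (Set.finite_univ (α := G.vertexSet × G.vertexSet))).subset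
    fun a ha => ⟨ha.1.edge_mem, Set.mem_univ _⟩

variable [DecidableEq G.vertexSet] {c y : G.vertexSet}
  {F : Finset (β × G.vertexSet × G.vertexSet)}

/-- The vertices on a walk from `c` with arc set `F`. -/
def trailVerts (c : G.vertexSet) (F : Finset (β × G.vertexSet × G.vertexSet)) :
    Finset G.vertexSet :=
  insert c (F.image fun a => a.2.2)

/-- The subgraph of `G` traced by a walk from `c` with arc set `F`. -/
def trailGraph (c : G.vertexSet) (F : Finset (β × G.vertexSet × G.vertexSet)) : Graph α β :=
  (G.restrict (Prod.fst '' (F : Set (β × G.vertexSet × G.vertexSet)))).induce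
    (Subtype.val '' (trailVerts c F : Set G.vertexSet))

lemma trailGraph_le : trailGraph c F ≤ G :=
  (Graph.induce_le (by rintro _ ⟨x, -, rfl⟩; exact x.2)).trans Graph.restrict_le

lemma val_mem_trailGraph {x : G.vertexSet} :
    (x : α) ∈ (trailGraph c F).vertexSet ↔ x ∈ trailVerts c F := by
  simp [trailGraph]

lemma exists_mem_of_mem_trailGraph {e : β} (he : e ∈ (trailGraph c F).edgeSet) :
    ∃ x y, (e, x, y) ∈ F := by
  obtain ⟨x, y, h, -, -⟩ := he
  obtain ⟨⟨e', x', y'⟩, ha, rfl⟩ := h.1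
  exact ⟨x', y', ha⟩

variable [DecidableEq β]

lemma IsTrail.end_mem (h : IsTrail c y F) : y ∈ trailVerts c F := by
  cases h <;> simp [trailVerts]

lemma IsTrail.source_mem (h : IsTrail c y F) : ∀ a ∈ F, a.2.1 ∈ trailVerts c F := by
  induction h with
  | nil => simp
  | @snoc x y e F h ih =>
    have hsub : trailVerts c F ⊆ trailVerts c (insert (e, x, y) F) :=
      Finset.insert_subset_insert _ (Finset.image_subset_image (Finset.subset_insert _ _))
    intro a ha
    rcases Finset.mem_insert.1 ha with rfl | ha
    · exact hsub h.end_mem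
    · exact hsub (ih a ha)

/-- Every vertex of a walk other than its end starts one of its arcs. -/
lemma IsTrail.eq_or_exists_source (h : IsTrail c y F) :
    ∀ x ∈ trailVerts c F, x = y ∨ ∃ a ∈ F, a.2.1 = x := by
  induction h with
  | nil => simp [trailVerts]
  | @snoc x y e F h ih =>
    intro z hz
    have hz' : z = y ∨ z ∈ trailVerts c F := by
      simp only [trailVerts, Finset.image_insert, Finset.mem_insert] at hz ⊢
      tauto
    rcases hz' with rfl | hz'
    · exact Or.inl rfl
    · right
      rcases ih z hz' with rfl | ⟨a, ha, rfl⟩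
      · exact ⟨_, Finset.mem_insert_self _ _, rfl⟩
      · exact ⟨a, Finset.mem_insert_of_mem ha, rfl⟩

lemma IsTrail.reflTransGen (h : IsTrail c y F) :
    ∀ x ∈ trailVerts c F, Relation.ReflTransGen (fun u v => ∃ e, (e, u, v) ∈ F) c x := by
  induction h with
  | nil => simp [trailVerts, Relation.ReflTransGen.refl]
  | @snoc x y e F h ih =>
    intro z hz
    have hmono : ∀ w, Relation.ReflTransGen (fun u v => ∃ e, (e, u, v) ∈ F) c w →
        Relation.ReflTransGen (fun u v => ∃ e', (e', u, v) ∈ insert (e, x, y) F) c w :=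
      fun w hw => Relation.ReflTransGen.mono
        (fun u v ⟨f, hf⟩ => ⟨f, Finset.mem_insert_of_mem hf⟩) _ _ hw
    have hz' : z = y ∨ z ∈ trailVerts c F := by
      simp only [trailVerts, Finset.image_insert, Finset.mem_insert] at hz ⊢
      tauto
    rcases hz' with rfl | hz'
    · exact (hmono x (ih x h.end_mem)).tail ⟨e, Finset.mem_insert_self _ _⟩
    · exact hmono z (ih z hz')

lemma IsTrail.connected_trailGraph (h : IsTrail c y F) (hF : ∀ a ∈ F, a ∈ arcSet G) :
    (trailGraph c F).Connected := by
  have hadj : ∀ u v : G.vertexSet, (∃ e, (e, u, v) ∈ F) → (trailGraph c F).Adj u v := by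
    rintro u v ⟨e, he⟩
    refine ⟨e, ⟨⟨_, he, rfl⟩, (hF _ he).1⟩, ⟨u, h.source_mem _ he, rfl⟩, ⟨v, ?_, rfl⟩⟩
    exact Finset.mem_insert_of_mem (Finset.mem_image_of_mem (fun a => a.2.2) he)
  have hreach : ∀ x ∈ (trailGraph c F).vertexSet, (trailGraph c F).Reachable c x := by
    rintro _ ⟨x, hx, rfl⟩
    exact (h.reflTransGen x hx).lift Subtype.val hadj
  refine ⟨⟨c, val_mem_trailGraph.2 (Finset.mem_insert_self _ _)⟩, fun x hx y hy => ?_⟩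
  refine Relation.ReflTransGen.trans ?_ (hreach y hy)
  exact Relation.ReflTransGen.stdSymm.symm _ _ (hreach x hx)

end Graphs

/-! ### Multistars and their immersions -/

section Multistar

variable {γ δ α β : Type*} {H : Graph γ δ} {G : Graph α β} {c : γ}

lemma multistar_inc {n k : ℕ} {e : Fin n × Fin k} {v : Option (Fin n)} :
    (Graph.multistar n k).Inc e v ↔ v = none ∨ v = some e.1 := by
  simp only [Graph.Inc, Graph.multistar]
  constructor
  · rintro ⟨x, h | h⟩ <;> tauto
  · rintro (rfl | rfl)
    · exact ⟨some e.1, by simp⟩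
    · exact ⟨none, by simp⟩

lemma exists_inc_of_mem_rays (hH : H.IsMultistar c) {h : γ} (hh : h ∈ H.rays c) :
    ∃ e, H.IsLink e c h := by
  have hr := hH.connected.2 h hh.1 c hH.center_mem
  rcases Relation.ReflTransGen.cases_head hr with rfl | ⟨x, ⟨e, he⟩, -⟩
  · exact absurd rfl hh.2
  · rcases (hH.inc_center e he.edge_mem).eq_or_eq_of_isLink he with rfl | rfl
    · exact absurd rfl hh.2
    · exact ⟨e, he.symm⟩

lemma exists_ray_of_mem_edgeSet (hH : H.IsMultistar c) {e : δ} (he : e ∈ H.edgeSet) :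
    ∃ h ∈ H.rays c, H.Inc e h := by
  obtain ⟨x, hx⟩ := hH.inc_center e he
  refine ⟨x, ⟨hx.right_mem, ?_⟩, hx.inc_right⟩
  rintro rfl
  exact hH.no_loops e _ hx

/-- The edges of a multistar, whose rays have degree at most `k`, number at most `k` per ray. -/
lemma encard_edgeSet_le (hH : H.IsMultistar c) (hfin : (H.rays c).Finite) {k : ℕ}
    (hdeg : ∀ v ∈ H.rays c, H.degree v ≤ k) :
    H.edgeSet.encard ≤ (k * (H.rays c).ncard : ℕ) := by
  have hsub : H.edgeSet ⊆ ⋃ v ∈ hfin.toFinset, H.incidenceSet v := by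
    intro e he
    obtain ⟨h, hh, hinc⟩ := exists_ray_of_mem_edgeSet hH he
    exact Set.mem_biUnion (by simpa using hh) hinc
  refine (Set.encard_le_encard hsub).trans ((hfin.toFinset.set_encard_biUnion_le _).trans ?_)
  refine (Finset.sum_le_card_nsmul _ _ (k : ℕ∞) fun v hv => ?_).trans ?_
  · exact le_self_add.trans (hdeg v (by simpa using hv))
  · rw [Set.ncard_eq_toFinset_card _ hfin, nsmul_eq_mul, mul_comm]
    push_cast
    rfl

variable [DecidableEq G.vertexSet]

/-- A vertex that no fewer than `k` edges separate from `c` lies only in sets that at least `k` arcs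
enter. -/
lemma le_card_inArcs [DecidableEq β] {A₀ : Finset (β × G.vertexSet × G.vertexSet)}
    (hA₀ : ∀ a, a ∈ A₀ ↔ a ∈ arcSet G) {k : ℕ} {c v : G.vertexSet}
    (hcut : ¬ ∃ K : Set β, K.encard < k ∧ G.IsEdgeCutSeparating K c v)
    {Y : Finset G.vertexSet} (hcY : c ∉ Y) (hvY : v ∈ Y) : k ≤ (inArcs A₀ Y).card := by
  by_contra hlt
  push Not at hlt
  refine hcut ⟨((inArcs A₀ Y).image Prod.fst : Finset β), ?_, ?_, fun hr => ?_⟩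
  · rw [Set.encard_coe_eq_coe_finsetCard]
    exact_mod_cast Finset.card_image_le.trans_lt hlt
  · intro e he
    obtain ⟨a, ha, rfl⟩ := Finset.mem_image.1 (Finset.mem_coe.1 he)
    exact ((hA₀ a).1 (mem_inArcs.1 ha).1).1.edge_mem
  · obtain ⟨e, a, b, hlink, ha, hb⟩ := exists_isLink_of_reachable hr
      (Y := Subtype.val '' (Y : Set G.vertexSet)) (by simpa using hcY) (by simpa using hvY)
    obtain ⟨b, hbY, rfl⟩ := hb
    rw [Graph.deleteEdges_isLink] at hlink
    have haY : (⟨a, hlink.1.left_mem⟩ : G.vertexSet) ∉ Y := fun h => ha ⟨_, h, rfl⟩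
    refine hlink.2 (Finset.mem_coe.2 (Finset.mem_image.2
      ⟨(e, ⟨a, hlink.1.left_mem⟩, b), mem_inArcs.2 ⟨(hA₀ _).2 ⟨hlink.1, ?_⟩, haY, hbY⟩, rfl⟩))
    intro h
    simp only at h
    exact haY (by rw [h]; exact hbY)

/-- A strong immersion of a multistar provides disjoint connections of its rays to its centre that
do not pass through other rays. -/
lemma meets_of_strong_immersion {A₀ : Finset (β × G.vertexSet × G.vertexSet)}
    (hA₀ : ∀ a, a ∈ A₀ ↔ a ∈ arcSet G) (hH : H.IsMultistar c) (σ : Graph.Immersion H G)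
    (hσ : σ.IsStrong) {R : Finset G.vertexSet}
    (hR : ∀ v, v ∈ R ↔ ∃ h ∈ H.rays c, σ.vert h = v) {c' : G.vertexSet}
    (hc' : σ.vert c = c') : Meets (avoid A₀ R) c' fun Y => (R ∩ Y).card := by
  intro Y hcY
  have key : ∀ v ∈ R ∩ Y, ∃ f h a, σ.vert h = v ∧ H.IsLink f c h ∧
      a ∈ inArcs (avoid A₀ R) Y ∧ a.1 ∈ (σ.sub f).edgeSet := by
    intro v hv
    rw [Finset.mem_inter, hR] at hv
    obtain ⟨⟨h, hh, hhv⟩, hvY⟩ := hv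
    obtain ⟨f, hf⟩ := exists_inc_of_mem_rays hH hh
    have hr := (σ.sub_connected f hf.edge_mem).2 _ (σ.vert_mem_sub f c hf.inc_left) _
      (σ.vert_mem_sub f h hf.inc_right)
    obtain ⟨e, a, b, hlink, ha, hb⟩ := exists_isLink_of_reachable hr
      (Y := Subtype.val '' (Y : Set G.vertexSet)) (by simpa [hc'] using hcY)
      (by simpa [hhv] using hvY)
    obtain ⟨b, hbY, rfl⟩ := hb
    have hlink' := hlink.mono (σ.sub_le f hf.edge_mem)
    have haY : (⟨a, hlink'.left_mem⟩ : G.vertexSet) ∉ Y := fun h => ha ⟨_, h, rfl⟩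
    refine ⟨f, h, (e, ⟨a, hlink'.left_mem⟩, b), hhv, hf,
      mem_inArcs.2 ⟨mem_avoid.2 ⟨(hA₀ _).2 ⟨hlink', ?_⟩, fun haR => ?_⟩, haY, hbY⟩, hlink.edge_mem⟩
    · intro h
      simp only at h
      exact haY (by rw [h]; exact hbY)
    · -- a vertex of `R` in the image of `f` can only be `v`, which lies in `Y`
      obtain ⟨h', hh', hh'a⟩ := (hR _).1 haR
      by_cases hinc : H.Inc f h'
      · have : h' = h := hinc.eq_of_isLink_of_ne_left hf hh'.2
        subst this
        have : v = ⟨a, hlink'.left_mem⟩ := Subtype.ext (hhv.symm.trans hh'a)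
        exact haY (this ▸ hvY)
      · apply hσ f hf.edge_mem h' hh'.1 hinc
        rw [hh'a]
        exact hlink.left_mem
  choose f h a hhv hf ha hsub using key
  simp only
  rw [← Finset.card_attach]
  refine Finset.card_le_card_of_injOn (fun v => a v.1 v.2) (fun v _ => ha v.1 v.2) ?_
  rintro ⟨v, hv⟩ - ⟨w, hw⟩ - hvw
  simp only at hvw
  have hff : f v hv = f w hw := by
    by_contra hne
    refine Set.disjoint_left.1
      (σ.edge_disjoint _ (hf v hv).edge_mem _ (hf w hw).edge_mem hne) (hsub v hv) ?_
    rw [hvw]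
    exact hsub w hw
  have hhh : h v hv = h w hw := by
    have := hf v hv
    rw [hff] at this
    exact this.right_unique (hf w hw)
  exact Subtype.ext (Subtype.ext (by rw [← hhv v hv, ← hhv w hw, hhh]))

/-- If the cut condition for `k` walks to each vertex of `R` holds in the arcs that do not start in
`R`, then `S_{n,k}` has a strong immersion with its rays in `R`. -/
lemma exists_immersion_of_meets [DecidableEq β] {A₀ : Finset (β × G.vertexSet × G.vertexSet)}
    (hA₀ : ∀ a, a ∈ A₀ ↔ a ∈ arcSet G) {k n : ℕ} {c : G.vertexSet} {R : Finset G.vertexSet}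
    (hcR : c ∉ R) (hn : n ≤ R.card)
    (hR : Meets (avoid A₀ R) c fun Y => k * (R ∩ Y).card) :
    ∃ θ : Graph.Immersion (Graph.multistar n k) G, θ.IsStrong ∧ θ.vert none = c ∧
      ∀ i, ∃ v ∈ R, θ.vert (some i) = v := by
  obtain ⟨r⟩ : Nonempty (Fin n ↪ R) := Function.Embedding.nonempty_of_card_le (by simpa using hn)
  have hr : ∀ i j, (r i : G.vertexSet) = r j → i = j := fun i j h => r.injective (Subtype.ext h)
  let t : Fin n × Fin k → G.vertexSet := fun p => r p.1
  have ht : Meets (avoid A₀ R) c fun Y => (Finset.univ.filter fun p => t p ∈ Y).card := by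
    intro Y hcY
    refine le_trans ?_ (hR Y hcY)
    have h1 : (Finset.univ.filter fun p => t p ∈ Y) =
        (Finset.univ.filter fun i => (r i : G.vertexSet) ∈ Y) ×ˢ (Finset.univ : Finset (Fin k)) := by
      ext p; simp [t]
    simp only
    rw [h1, Finset.card_product, Finset.card_univ, Fintype.card_fin, mul_comm]
    refine Nat.mul_le_mul_left k (Finset.card_le_card_of_injOn (fun i => (r i : G.vertexSet))
      (fun i hi => ?_) fun i _ j _ hij => hr i j hij)
    simp only [Finset.coe_filter, Finset.mem_univ, true_and, Set.mem_ofPred_eq] at hi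
    exact Finset.mem_coe.2 (Finset.mem_inter.2 ⟨(r i).2, hi⟩)
  obtain ⟨B, hBA, hB, hor⟩ := ht.exists_oriented (modular_card_filter t)
  have hBarc : ∀ a ∈ B, a ∈ arcSet G := fun a ha => (hA₀ a).1 (mem_avoid.1 (hBA ha)).1
  obtain ⟨F, hF, hdisj⟩ := exists_disjoint_trails B (fun a ha => (hBarc a ha).2) t hB
  let vert : Option (Fin n) → α := fun v => v.elim c fun i => (r i : G.vertexSet)
  have hrc : ∀ i, (r i : G.vertexSet) ≠ c := fun i h => hcR (h ▸ (r i).2)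
  refine ⟨⟨vert, fun p => trailGraph c (F p), ?_, ?_, fun p _ => trailGraph_le, ?_, ?_, ?_, ?_⟩,
    ?_, rfl, fun i => ⟨r i, (r i).2, rfl⟩⟩
  · rintro (_ | i) -
    · exact c.2
    · exact (r i : G.vertexSet).2
  · rintro (_ | i) - (_ | j) - hij
    · rfl
    · exact absurd (Subtype.ext hij.symm) (hrc j)
    · exact absurd (Subtype.ext hij) (hrc i)
    · rw [hr i j (Subtype.ext hij)]
  · exact fun p _ => (hF p).1.connected_trailGraph fun a ha => hBarc a ((hF p).2 ha)
  · -- an edge on two walks would be a common arc of them or give two opposite arcs of `B`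
    intro p _ q _ hpq
    rw [Set.disjoint_left]
    intro e he he'
    obtain ⟨x, y, hxy⟩ := exists_mem_of_mem_trailGraph he
    obtain ⟨x', y', hxy'⟩ := exists_mem_of_mem_trailGraph he'
    have hl := (hBarc _ ((hF p).2 hxy)).1
    have hl' := (hBarc _ ((hF q).2 hxy')).1
    rcases hl.eq_and_eq_or_eq_and_eq hl' with ⟨h1, h2⟩ | ⟨h1, h2⟩
    · obtain rfl := Subtype.ext h1
      obtain rfl := Subtype.ext h2
      exact Finset.disjoint_left.1 (hdisj p q hpq) hxy hxy'
    · obtain rfl := Subtype.ext h1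
      obtain rfl := Subtype.ext h2
      exact hor _ _ _ _ ((hF p).2 hxy) ((hF q).2 hxy')
  · intro p v hv
    rcases multistar_inc.1 hv with rfl | rfl
    · exact val_mem_trailGraph.2 (Finset.mem_insert_self _ _)
    · exact val_mem_trailGraph.2 (hF p).1.end_mem
  · rintro p v (⟨rfl, h⟩ | ⟨rfl, h⟩) <;> simp at h
  · intro p _ v _ hinc hmem
    rw [multistar_inc, not_or] at hinc
    rcases v with _ | i
    · exact hinc.1 rfl
    · -- a vertex of `R` inside a walk would start an arc, but these arcs were removed
      rcases (hF p).1.eq_or_exists_source _ (val_mem_trailGraph.1 hmem) with h | ⟨a, ha, h⟩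
      · exact hinc.2 (by rw [hr _ _ h])
      · refine (mem_avoid.1 (hBA ((hF p).2 ha))).2 ?_
        rw [h]
        exact (r i).2

end Multistar

/-! ### The bound and the conclusion -/

lemma le_immersionBound (k : ℕ) (hk : 1 ≤ k) :
    k * ((2 * k + 1) * ((k + 1) * (k ^ k + 1))) ≤ Graph.immersionBound k := by
  have h1 : k ^ k + 1 ≤ (2 * k + 1) ^ (8 * k + 3) := by
    calc k ^ k + 1 ≤ k ^ k * 2 := by linarith [Nat.one_le_pow k k hk]
      _ ≤ (2 * k + 1) ^ k * (2 * k + 1) :=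
        Nat.mul_le_mul (Nat.pow_le_pow_left (by omega) k) (by omega)
      _ = (2 * k + 1) ^ (k + 1) := (pow_succ _ _).symm
      _ ≤ (2 * k + 1) ^ (8 * k + 3) := Nat.pow_le_pow_right (by omega) (by omega)
  calc k * ((2 * k + 1) * ((k + 1) * (k ^ k + 1)))
      ≤ k * ((2 * k + 1) * ((k + 1) * (2 * k + 1) ^ (8 * k + 3))) := by gcongr
    _ ≤ k * (k * ((2 * k + 1) * ((k + 1) * (2 * k + 1) ^ (8 * k + 3)))) := by
        exact Nat.mul_le_mul_left k (Nat.le_mul_of_pos_left _ hk)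
    _ = Graph.immersionBound k := by
        rw [Graph.immersionBound, pow_succ _ (8 * k + 3)]; ring

end ArcCut

open ArcCut in
theorem theorem2 {α β γ δ : Type*} (k n : ℕ) (hk : 3 ≤ k) (hn : 2 ≤ n)
    (G : Graph α β) (hV : G.vertexSet.Finite) (hE : G.edgeSet.Finite)
    (H : Graph γ δ) (c : γ) (σ : Graph.Immersion H G)
    (hσ : Graph.IsKSystem k (Graph.immersionBound k * n) H c G σ) :
    ∃ θ : Graph.Immersion (Graph.multistar n k) G, θ.IsStrong ∧ θ.Respects c σ := by
  classical
  have : Finite G.vertexSet := hV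
  have : Fintype G.vertexSet := Fintype.ofFinite _
  have hH := hσ.isMultistar
  let c' : G.vertexSet := ⟨σ.vert c, σ.vert_mem c hH.center_mem⟩
  let A₀ := (arcSet_finite hV hE).toFinset
  have hA₀ : ∀ a, a ∈ A₀ ↔ a ∈ arcSet G := fun a => by simp [A₀]
  let R : Finset G.vertexSet := Finset.univ.filter fun v => ∃ h ∈ H.rays c, σ.vert h = v
  have hR : ∀ v, v ∈ R ↔ ∃ h ∈ H.rays c, σ.vert h = v := fun v => by simp [R]
  have hinj : Set.InjOn σ.vert (H.rays c) := σ.vert_injOn.mono fun v hv => hv.1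
  have himage : σ.vert '' H.rays c = Subtype.val '' (R : Set G.vertexSet) := by
    ext x
    constructor
    · rintro ⟨h, hh, rfl⟩
      exact ⟨⟨σ.vert h, σ.vert_mem h hh.1⟩, Finset.mem_coe.2 ((hR _).2 ⟨h, hh, rfl⟩), rfl⟩
    · rintro ⟨v, hv, rfl⟩
      exact (hR v).1 (Finset.mem_coe.1 hv)
  have hfin : (H.rays c).Finite :=
    Set.Finite.of_finite_image (himage ▸ R.finite_toSet.image _) hinj
  have hcard : (H.rays c).ncard = R.card := by
    rw [← hinj.ncard_image, himage,
      Set.ncard_image_of_injective _ Subtype.val_injective, Set.ncard_coe_finset]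
  have hmag : Graph.immersionBound k * n ≤ k * R.card := by
    have := hσ.le_card_edges.trans (encard_edgeSet_le hH hfin hσ.degree_le)
    rw [hcard] at this
    exact_mod_cast this
  obtain ⟨R', hR', hle, hmeets⟩ := exists_linked_subset (A₀ := A₀) (k := k) (R := R) (c := c')
    (by omega) (fun e x y h => (hA₀ _).2 ⟨((hA₀ _).1 h).1.symm, ((hA₀ _).1 h).2.symm⟩)
    (by
      intro v hv Y hcY hvY
      obtain ⟨h, hh, hhv⟩ := (hR v).1 hv
      refine le_card_inArcs hA₀ ?_ hcY hvY
      rw [← hhv]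
      exact hσ.no_small_cut h hh)
    (meets_of_strong_immersion hA₀ hH σ hσ.isStrong hR rfl)
  have hcR : c' ∉ R := by
    intro h
    obtain ⟨x, hx, hxc⟩ := (hR _).1 h
    exact hx.2 (σ.vert_injOn hx.1 hH.center_mem hxc)
  have hnR' : n ≤ R'.card := by
    have hpos : 0 < k * ((2 * k + 1) * ((k + 1) * (k ^ k + 1))) := by positivity
    refine Nat.le_of_mul_le_mul_left ?_ hpos
    calc k * ((2 * k + 1) * ((k + 1) * (k ^ k + 1))) * n
        ≤ Graph.immersionBound k * n := Nat.mul_le_mul_right n (le_immersionBound k (by omega))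
      _ ≤ k * R.card := hmag
      _ ≤ k * ((2 * k + 1) * ((k + 1) * (k ^ k + 1) * R'.card)) := Nat.mul_le_mul_left k hle
      _ = k * ((2 * k + 1) * ((k + 1) * (k ^ k + 1))) * R'.card := by ring
  obtain ⟨θ, hθ, hθc, hθr⟩ := exists_immersion_of_meets hA₀ (fun h => hcR (hR' h)) hnR' hmeets
  refine ⟨θ, hθ, hθc, ?_⟩
  rintro _ ⟨v, hv, rfl⟩
  rcases v with _ | i
  · exact absurd rfl hv.2
  · obtain ⟨v, hvR', hiv⟩ := hθr i
    rw [hiv, himage]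
    exact ⟨v, Finset.mem_coe.2 (hR' hvR'), rfl⟩
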